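/- Let $(L,\leqslant)$ be an infinite linearly ordered set and let $n$ be a natural number. Let $\mathscr{I}^n(L)$ be the semigroup of all partial bijections $\alpha\colon L\rightharpoonup L$ with $|\operatorname{dom}\alpha|\leqslant n$, under composition of partial maps, $x(\alpha\beta)=(x\alpha)\beta$ (the symmetric inverse semigroup of rank $\leqslant n$ over $L$), and let $\mathscr{O\!\!I}_n(L)$ be its subsemigroup of all partial order isomorphisms, i.e. of those $\alpha\in\mathscr{I}^n(L)$ for which $x_1\leqslant x_2$ implies $(x_1)\alpha\leqslant (x_2)\alpha$ for all $x_1,x_2\in\operatorname{dom}\alpha$. A topology on a semigroup is called shift-continuous if all left translations $x\mapsto ax$ and all right translations $x\mapsto xa$ are continuous. Then there exists exactly one Hausdorff compact shift-continuous topology $\tau$ on $\mathscr{O\!\!I}_n(L)$. Moreover, there exists exactly one Hausdorff compact shift-continuous topology $\sigma$ on $\mathscr{I}^n(L)$ whose subspace topology on $\mathscr{O\!\!I}_n(L)$ is $\tau$. -/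

import Mathlib

/-- The symmetric inverse semigroup `I(X)`: partial bijections of `X` (`PEquiv`), multiplied by
composing from left to right, `x (α β) = (x α) β`. -/
instance PEquiv.instSemigroupSelf (X : Type*) : Semigroup (X ≃. X) where
  mul α β := α.trans β
  mul_assoc α β γ := PEquiv.trans_assoc α β γ

theorem PEquiv.mul_eq_trans {X : Type*} (α β : X ≃. X) : α * β = α.trans β := rfl

/-- The domain of a partial bijection. -/
def PEquiv.dom {X Y : Type*} (α : X ≃. Y) : Set X := {x | ∃ y, y ∈ α x}

/-- The rank of a partial bijection is the cardinality of its domain (`⊤` if it is infinite). -/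
noncomputable def PEquiv.rank {X Y : Type*} (α : X ≃. Y) : ℕ∞ := α.dom.encard

theorem PEquiv.dom_mul_subset {X : Type*} (α β : X ≃. X) : (α * β).dom ⊆ α.dom := by
  rintro x ⟨z, hz⟩
  obtain ⟨y, hy, -⟩ := (PEquiv.mem_trans α β x z).1 hz
  exact ⟨y, hy⟩

/-- `I^n(X)`: the symmetric inverse semigroup of rank `≤ n` over `X`. -/
def symInvRank (n : ℕ) (X : Type*) : Subsemigroup (X ≃. X) where
  carrier := {α | α.rank ≤ n}
  mul_mem' := fun {α β} hα _ => (Set.encard_le_encard (PEquiv.dom_mul_subset α β)).trans hα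

/-- `OI(L)`: the semigroup of all partial order isomorphisms of a linearly ordered set `L`,
that is, of the partial bijections that preserve `≤` on their domain. -/
def partialOrderIso (L : Type*) [LinearOrder L] : Subsemigroup (L ≃. L) where
  carrier := {α | ∀ x₁ x₂ y₁ y₂ : L, y₁ ∈ α x₁ → y₂ ∈ α x₂ → x₁ ≤ x₂ → y₁ ≤ y₂}
  mul_mem' := by
    intro α β hα hβ x₁ x₂ z₁ z₂ h₁ h₂ hx
    obtain ⟨y₁, hy₁, hz₁⟩ := (PEquiv.mem_trans α β x₁ z₁).1 h₁
    obtain ⟨y₂, hy₂, hz₂⟩ := (PEquiv.mem_trans α β x₂ z₂).1 h₂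
    exact hβ y₁ y₂ z₁ z₂ hz₁ hz₂ (hα x₁ x₂ y₁ y₂ hy₁ hy₂ hx)

/-- `OI_n(L)`: the partial order isomorphisms of `L` of rank `≤ n`. -/
def partialOrderIsoRank (n : ℕ) (L : Type*) [LinearOrder L] : Subsemigroup (L ≃. L) :=
  partialOrderIso L ⊓ symInvRank n L

theorem partialOrderIsoRank_le (n : ℕ) (L : Type*) [LinearOrder L] :
    partialOrderIsoRank n L ≤ symInvRank n L := inf_le_right

/-- `τ` is a Hausdorff compact shift-continuous topology on the semigroup `S`: all left and
all right translations of `S` are continuous (`SeparatelyContinuousMul`). -/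
structure IsHausdorffCompactShiftContinuous {S : Type*} [Semigroup S]
    (τ : TopologicalSpace S) : Prop where
  t2 : @T2Space S τ
  compact : @CompactSpace S τ
  separatelyContinuousMul : @SeparatelyContinuousMul S τ _

/-! Existence: identifying a partial bijection with its graph embeds `X ≃. X` as a closed subset of
a Cantor cube. Translations are continuous there, and bounded rank and monotonicity are closed
conditions, so both semigroups inherit a suitable topology. Uniqueness: in any Hausdorff
shift-continuous topology, sandwiching `α` between `single x x` and `single y y` detects whether `y
∈ α x`, so this condition is clopen (`isClopen_setOf_mem_of_separatelyContinuousMul`). Hence the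
inclusion into `X ≃. X` is continuous, and compactness makes it an embedding. -/

namespace PEquiv

variable {X Y : Type*}

open Classical in
/-- The indicator function of the graph of a partial bijection. -/
noncomputable def graphIndicator (α : X ≃. Y) (p : X × Y) : Bool := decide (p.2 ∈ α p.1)

theorem graphIndicator_eq_true {α : X ≃. Y} {p : X × Y} :
    α.graphIndicator p = true ↔ p.2 ∈ α p.1 := by
  simp [graphIndicator]

theorem ext_mem {α β : X ≃. Y} (h : ∀ x y, y ∈ α x ↔ y ∈ β x) : α = β :=
  PEquiv.ext fun x => Option.ext fun y => h x y

theorem graphIndicator_injective : Function.Injective (graphIndicator (X := X) (Y := Y)) := by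
  intro α β h
  refine ext_mem fun x y => ?_
  rw [← graphIndicator_eq_true (p := (x, y)), h, graphIndicator_eq_true]

open Classical in
/-- The partial bijection whose graph is a given relation that is functional and injective. -/
noncomputable def ofRel (R : X → Y → Prop) (hf : ∀ x y y', R x y → R x y' → y = y')
    (hi : ∀ x x' y, R x y → R x' y → x = x') : X ≃. Y where
  toFun x := if h : ∃ y, R x y then some h.choose else none
  invFun y := if h : ∃ x, R x y then some h.choose else none
  inv x y := by
    have h₁ : (∃ h : ∃ x, R x y, h.choose = x) ↔ R x y :=
      ⟨fun ⟨h, e⟩ => e ▸ h.choose_spec,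
        fun h => ⟨⟨x, h⟩, hi _ _ _ (Exists.choose_spec (⟨x, h⟩ : ∃ x, R x y)) h⟩⟩
    have h₂ : (∃ h : ∃ y, R x y, h.choose = y) ↔ R x y :=
      ⟨fun ⟨h, e⟩ => e ▸ h.choose_spec,
        fun h => ⟨⟨y, h⟩, hf _ _ _ (Exists.choose_spec (⟨y, h⟩ : ∃ y, R x y)) h⟩⟩
    simpa [Option.mem_def, Option.dite_none_right_eq_some] using h₁.trans h₂.symm

theorem mem_ofRel {R : X → Y → Prop} {hf : ∀ x y y', R x y → R x y' → y = y'}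
    {hi : ∀ x x' y, R x y → R x' y → x = x'} {x : X} {y : Y} : y ∈ ofRel R hf hi x ↔ R x y := by
  classical
  change y ∈ (if h : ∃ y, R x y then some h.choose else none) ↔ R x y
  simp only [Option.mem_def, Option.dite_none_right_eq_some, Option.some.injEq]
  exact ⟨fun ⟨h, e⟩ => e ▸ h.choose_spec,
    fun h => ⟨⟨y, h⟩, hf _ _ _ (Exists.choose_spec (⟨y, h⟩ : ∃ y, R x y)) h⟩⟩

theorem range_graphIndicator : Set.range (graphIndicator (X := X) (Y := Y)) =
    {f | (∀ x y y', y ≠ y' → ¬(f (x, y) = true ∧ f (x, y') = true)) ∧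
      ∀ x x' y, x ≠ x' → ¬(f (x, y) = true ∧ f (x', y) = true)} := by
  ext f
  constructor
  · rintro ⟨α, rfl⟩
    refine ⟨fun x y y' hne h => hne ?_, fun x x' y hne h => hne ?_⟩
    · exact Option.mem_unique (graphIndicator_eq_true.1 h.1) (graphIndicator_eq_true.1 h.2)
    · exact α.inj (graphIndicator_eq_true.1 h.1) (graphIndicator_eq_true.1 h.2)
  · rintro ⟨hf, hi⟩
    refine ⟨ofRel (fun x y => f (x, y) = true)
      (fun x y y' h h' => by_contra fun hne => hf x y y' hne ⟨h, h'⟩)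
      (fun x x' y h h' => by_contra fun hne => hi x x' y hne ⟨h, h'⟩), funext fun p => ?_⟩
    rw [Bool.eq_iff_iff, graphIndicator_eq_true, mem_ofRel]

/-- The topology of pointwise convergence of graphs, inherited from the Cantor cube
`X × Y → Bool`. -/
noncomputable instance graphTopology : TopologicalSpace (X ≃. Y) :=
  TopologicalSpace.induced graphIndicator inferInstance

/-- Functionality and injectivity of a relation are intersections of conditions that each involve
only two coordinates of the cube. -/
theorem isClosedEmbedding_graphIndicator :
    Topology.IsClosedEmbedding (graphIndicator (X := X) (Y := Y)) := by
  refine ⟨⟨⟨rfl⟩, graphIndicator_injective⟩, ?_⟩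
  have hc (p q : X × Y) : IsClosed {f : X × Y → Bool | ¬(f p = true ∧ f q = true)} := by
    have : Continuous fun f : X × Y → Bool => (f p, f q) := by fun_prop
    exact (isClosed_discrete {b : Bool × Bool | ¬(b.1 = true ∧ b.2 = true)}).preimage this
  rw [range_graphIndicator, Set.ofPred_and]
  simp only [Set.ofPred_forall]
  exact (isClosed_iInter fun x => isClosed_iInter fun y => isClosed_iInter fun y' =>
    isClosed_iInter fun _ => hc _ _).inter (isClosed_iInter fun x => isClosed_iInter fun x' =>
    isClosed_iInter fun y => isClosed_iInter fun _ => hc _ _)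

instance : T2Space (X ≃. Y) := isClosedEmbedding_graphIndicator.isEmbedding.t2Space

instance : CompactSpace (X ≃. Y) := isClosedEmbedding_graphIndicator.compactSpace

theorem isClopen_setOf_mem (x : X) (y : Y) : IsClopen {α : X ≃. Y | y ∈ α x} := by
  have hc : Continuous fun α : X ≃. Y => α.graphIndicator (x, y) :=
    (continuous_apply _).comp isClosedEmbedding_graphIndicator.continuous
  have := (isClopen_discrete {true}).preimage hc
  simpa only [Set.preimage, Set.mem_singleton_iff, graphIndicator_eq_true] using this

theorem continuous_iff_isClopen {Z : Type*} [TopologicalSpace Z] {f : Z → X ≃. Y} :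
    Continuous f ↔ ∀ x y, IsClopen {z | y ∈ f z x} := by
  refine ⟨fun h x y => (isClopen_setOf_mem x y).preimage h, fun h => ?_⟩
  refine isClosedEmbedding_graphIndicator.isEmbedding.continuous_iff.2
    (continuous_pi fun p => continuous_bool_rng true |>.2 ?_)
  simpa only [Set.preimage, Set.mem_singleton_iff, Function.comp_apply, graphIndicator_eq_true]
    using h p.1 p.2

/-- With one factor fixed, each coordinate of the product is a single coordinate of the other
factor, or is constantly false. -/
instance : SeparatelyContinuousMul (X ≃. X) where
  continuous_const_mul {α} := by
    refine continuous_iff_isClopen.2 fun x y => ?_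
    simp only [mul_eq_trans, mem_trans]
    cases h : α x with
    | none => simpa using isClopen_empty
    | some z => simpa using isClopen_setOf_mem z y
  continuous_mul_const {α} := by
    refine continuous_iff_isClopen.2 fun x y => ?_
    simp only [mul_eq_trans, mem_trans, ← α.mem_iff_mem]
    cases h : α.symm y with
    | none => simpa using isClopen_empty
    | some z => simpa using isClopen_setOf_mem x z

/-- Rank above `n` is witnessed by `n + 1` points of the graph, and containing these is an open
condition. -/
theorem isClosed_symInvRank (n : ℕ) : IsClosed (symInvRank n X : Set (X ≃. X)) := by
  rw [← isOpen_compl_iff, isOpen_iff_forall_mem_open]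
  intro α hα
  have hα : (n : ℕ∞) < α.dom.encard := not_le.1 hα
  obtain ⟨t, ht, hcard⟩ := Set.exists_subset_encard_eq (Order.add_one_le_of_lt hα)
  have hfin : t.Finite := Set.finite_of_encard_eq_coe (k := n + 1) (by simpa using hcard)
  refine ⟨⋂ x ∈ t, {β | ∀ y ∈ α x, y ∈ β x}, fun β hβ hle => ?_,
    hfin.isOpen_biInter fun x hx => ?_, Set.mem_iInter₂.2 fun x _ y hy => hy⟩
  · have hsub : t ⊆ β.dom := fun x hx => by
      obtain ⟨y, hy⟩ := ht hx
      exact ⟨y, Set.mem_iInter₂.1 hβ x hx y hy⟩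
    have := (Set.encard_le_encard hsub).trans (show β.dom.encard ≤ n from hle)
    rw [hcard] at this
    exact absurd this (not_le.2 (by exact_mod_cast n.lt_succ_self))
  · obtain ⟨y, hy⟩ := ht hx
    have : {β : X ≃. X | ∀ y ∈ α x, y ∈ β x} = {β | y ∈ β x} := by
      ext β
      exact ⟨fun h => h y hy, fun h y' hy' => Option.mem_unique hy hy' ▸ h⟩
    exact this ▸ (isClopen_setOf_mem x y).isOpen

theorem isClosed_partialOrderIso (L : Type*) [LinearOrder L] :
    IsClosed (partialOrderIso L : Set (L ≃. L)) := by
  change IsClosed {α : L ≃. L | ∀ x₁ x₂ y₁ y₂, y₁ ∈ α x₁ → y₂ ∈ α x₂ → x₁ ≤ x₂ → y₁ ≤ y₂}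
  simp only [Set.ofPred_forall]
  refine isClosed_iInter fun x₁ => isClosed_iInter fun x₂ => isClosed_iInter fun y₁ =>
    isClosed_iInter fun y₂ => ?_
  exact isClosed_imp (isClopen_setOf_mem _ _).isOpen
    (isClosed_imp (isClopen_setOf_mem _ _).isOpen isClosed_const)

theorem isClosed_partialOrderIsoRank (n : ℕ) (L : Type*) [LinearOrder L] :
    IsClosed (partialOrderIsoRank n L : Set (L ≃. L)) :=
  (isClosed_partialOrderIso L).inter (isClosed_symInvRank n)

theorem isHausdorffCompactShiftContinuous_of_isClosed {S : Subsemigroup (X ≃. X)}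
    (hS : IsClosed (S : Set (X ≃. X))) :
    IsHausdorffCompactShiftContinuous (inferInstance : TopologicalSpace S) where
  t2 := inferInstance
  compact := isCompact_iff_compactSpace.1 hS.isCompact
  separatelyContinuousMul :=
    { continuous_const_mul := fun {a} =>
        ((continuous_const_mul (a : X ≃. X)).comp continuous_subtype_val).subtype_mk _
      continuous_mul_const := fun {a} =>
        ((continuous_mul_const (a : X ≃. X)).comp continuous_subtype_val).subtype_mk _ }

theorem single_mul_mul_single [DecidableEq X] (α : X ≃. X) (x y : X) :
    single x x * α * single y y = if y ∈ α x then single x y else ⊥ := by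
  refine ext_mem fun a b => ?_
  simp only [mul_eq_trans, mem_trans, mem_single_iff]
  split_ifs with h
  · rw [mem_single_iff]
    constructor
    · rintro ⟨_, ⟨_, ⟨rfl, rfl⟩, _⟩, rfl, rfl⟩
      exact ⟨rfl, rfl⟩
    · rintro ⟨rfl, rfl⟩
      exact ⟨_, ⟨_, ⟨rfl, rfl⟩, h⟩, rfl, rfl⟩
  · constructor
    · rintro ⟨_, ⟨_, ⟨rfl, rfl⟩, h'⟩, rfl, rfl⟩
      exact absurd h' h
    · rintro ⟨⟩

theorem single_ne_bot (x : X) (y : Y) [DecidableEq X] [DecidableEq Y] :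
    (single x y : X ≃. Y) ≠ ⊥ := fun h => by
  have := mem_single x y
  rw [h] at this
  cases this

theorem isClopen_setOf_mem_of_separatelyContinuousMul [DecidableEq X]
    {S : Subsemigroup (X ≃. X)} [TopologicalSpace S] [T2Space S] [SeparatelyContinuousMul S] {x y : X}
    (hx : single x x ∈ S) (hy : single y y ∈ S) :
    IsClopen {α : S | y ∈ (α : X ≃. X) x} := by
  let f : S → S := fun α => ⟨_, hx⟩ * α * ⟨_, hy⟩
  have hf : Continuous f := (continuous_mul_const _).comp (continuous_const_mul _)
  have hval (α : S) : (f α : X ≃. X) = if y ∈ (α : X ≃. X) x then single x y else ⊥ :=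
    single_mul_mul_single _ _ _
  have hiff (α β : S) : f α = f β ↔ (y ∈ (α : X ≃. X) x ↔ y ∈ (β : X ≃. X) x) := by
    rw [Subtype.ext_iff, hval, hval]
    by_cases hα : y ∈ (α : X ≃. X) x <;> by_cases hβ : y ∈ (β : X ≃. X) x <;>
      simp [hα, hβ, single_ne_bot, (single_ne_bot x y).symm]
  have hclosed (P : Prop) : IsClosed {α : S | y ∈ (α : X ≃. X) x ↔ P} := by
    -- `f` takes at most two values, so a nonempty set of this form is the fibre of `f` through any
    -- of its points.
    by_cases hP : ∃ β : S, y ∈ (β : X ≃. X) x ↔ P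
    · obtain ⟨β, hβ⟩ := hP
      have : {α : S | y ∈ (α : X ≃. X) x ↔ P} = f ⁻¹' {f β} := by
        ext α
        rw [Set.mem_preimage, Set.mem_singleton_iff, hiff, hβ, Set.mem_ofPred_eq]
      exact this ▸ isClosed_singleton.preimage hf
    · rw [Set.eq_empty_iff_forall_notMem.2 fun β hβ => hP ⟨β, hβ⟩]
      exact isClosed_empty
  refine ⟨by simpa using hclosed True, isClosed_compl_iff.1 ?_⟩
  simpa [Set.compl_ofPred] using hclosed False

/-- A subsemigroup that contains the one-point restrictions of the identity to the points of the
domains and ranges of its elements has at most one compact Hausdorff shift-continuous topology. -/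
theorem eq_subtype_of_isHausdorffCompactShiftContinuous [DecidableEq X]
    {S : Subsemigroup (X ≃. X)}
    (hS : ∀ α ∈ S, ∀ x y, y ∈ α x → single x x ∈ S ∧ single y y ∈ S)
    (τ : TopologicalSpace S) (hτ : IsHausdorffCompactShiftContinuous τ) :
    τ = instTopologicalSpaceSubtype := by
  have := hτ.t2
  have := hτ.compact
  have := hτ.separatelyContinuousMul
  have hc : @Continuous S (X ≃. X) τ _ Subtype.val := by
    refine continuous_iff_isClopen.2 fun x y => ?_
    by_cases h : ∃ α : S, y ∈ (α : X ≃. X) x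
    · obtain ⟨α, hα⟩ := h
      obtain ⟨hx, hy⟩ := hS α α.2 x y hα
      exact isClopen_setOf_mem_of_separatelyContinuousMul hx hy
    · have : {α : S | y ∈ (α : X ≃. X) x} = ∅ :=
        Set.eq_empty_iff_forall_notMem.2 fun α hα => h ⟨α, hα⟩
      exact this ▸ isClopen_empty
  exact (hc.isClosedEmbedding Subtype.val_injective).eq_induced

/-- A nonempty graph forces `1 ≤ n`, which leaves room for rank-one idempotents; this covers `n = 0`
without a separate case. -/
theorem mem_symInvRank_of_mem [DecidableEq X] {n : ℕ} {α : X ≃. X} (hα : α ∈ symInvRank n X) {x y : X}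
    (h : y ∈ α x) (z : X) : single z z ∈ symInvRank n X := by
  have h₁ : (1 : ℕ∞) ≤ α.dom.encard := Set.one_le_encard_iff_nonempty.2 ⟨x, y, h⟩
  have h₂ : (single z z).dom ⊆ {z} := by
    rintro a ⟨b, hb⟩
    exact ((mem_single_iff _ _ _ _).1 hb).1
  exact (Set.encard_le_encard h₂).trans
    ((Set.encard_singleton z).le.trans (h₁.trans hα))

theorem single_self_mem_partialOrderIso {L : Type*} [LinearOrder L] (z : L) :
    single z z ∈ partialOrderIso L := by
  intro x₁ x₂ y₁ y₂ h₁ h₂ _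
  obtain ⟨-, rfl⟩ := (mem_single_iff _ _ _ _).1 h₁
  obtain ⟨-, rfl⟩ := (mem_single_iff _ _ _ _).1 h₂
  exact le_rfl

end PEquiv

theorem corollary3p4 (L : Type*) [LinearOrder L] [Infinite L] (n : ℕ) :
    (∃! τ : TopologicalSpace (partialOrderIsoRank n L), IsHausdorffCompactShiftContinuous τ) ∧
    ∀ τ : TopologicalSpace (partialOrderIsoRank n L), IsHausdorffCompactShiftContinuous τ →
      ∃! σ : TopologicalSpace (symInvRank n L),
        IsHausdorffCompactShiftContinuous σ ∧
          TopologicalSpace.induced (Subsemigroup.inclusion (partialOrderIsoRank_le n L)) σ = τ := by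
  have hO := PEquiv.eq_subtype_of_isHausdorffCompactShiftContinuous
    (S := partialOrderIsoRank n L) fun α hα x y h => by
      have hs (z : L) : PEquiv.single z z ∈ partialOrderIsoRank n L :=
        Subsemigroup.mem_inf.2 ⟨PEquiv.single_self_mem_partialOrderIso z, PEquiv.mem_symInvRank_of_mem hα.2 h z⟩
      exact ⟨hs x, hs y⟩
  have hI := PEquiv.eq_subtype_of_isHausdorffCompactShiftContinuous
    (S := symInvRank n L) fun α hα x y h =>
      ⟨PEquiv.mem_symInvRank_of_mem hα h x, PEquiv.mem_symInvRank_of_mem hα h y⟩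
  refine ⟨⟨_, PEquiv.isHausdorffCompactShiftContinuous_of_isClosed
    (PEquiv.isClosed_partialOrderIsoRank n L), hO⟩, fun τ hτ => ⟨_,
      ⟨PEquiv.isHausdorffCompactShiftContinuous_of_isClosed (PEquiv.isClosed_symInvRank n), ?_⟩,
      fun σ hσ => hI σ hσ.1⟩⟩
  rw [hO τ hτ]
  -- Both topologies are induced from `X ≃. X`, and the inclusions compose.
  exact induced_compose
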